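/- Let $G, H, E, F$ be real Banach spaces and let $X\subseteq G$, $Y\subseteq H$ be open sets. Assume that there is a $C^\infty$ function $\varphi:G\to\mathbb R$ with $\varphi(x)=1$ if $\|x\|\le 1/2$, $\varphi(x)=0$ if $\|x\|\ge 1$, and $\sup_{x\in G}\|D^k\varphi(x)\|<\infty$ for every $k\ge 0$. Let $C^\infty(X,E)$ be the space of infinitely Fréchet differentiable functions $X\to E$ with the locally convex topology generated by the seminorms $\rho_{K,k}(f)=\sup_{x\in K}\max_{0\le j\le k}\|D^jf(x)\|$, $K\subseteq X$ compact, $k\ge 0$; likewise for $C^\infty(Y,F)$. Let $T:C^\infty(X,E)\to C^\infty(Y,F)$ be a linear operator that is - separating: if for every $x\in X$ one of $f(x),g(x)$ is $0$, then for every $y\in Y$ one of $Tf(y),Tg(y)$ is $0$; - nowhere trivial: for every $y\in Y$ there is $f\in C^\infty(X,E)$ with $Tf(y)\ne 0$; and that maps some non-empty open subset of $C^\infty(X,E)$ onto a bounded subset of $C^\infty(Y,F)$ (a set absorbed by every neighbourhood of $0$). Let $\mathbb R_\infty$ be the one-point compactification of $\mathbb R$, let $i:X\to\mathbb R_\infty^{C^\infty(X,\mathbb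 R)}$, $i(x)=(\varphi(x))_\varphi$, and let $\mathcal AX$ be the closure of $i(X)$ in this product. For $y\in Y$ let $\mathcal O_y$ be the family of all open sets $U\subseteq\mathcal AX$ for which there is $f\in C^\infty(X,E)$ with $Tf(y)\neq 0$ and $\overline{i(\{x\in X:f(x)\ne0\})}\subseteq U$ (all closures are taken in $\mathcal AX$). Then for every $y\in Y$ the set $\bigcap_{U\in\mathcal O_y}\overline U$ consists of exactly one point, and this point is $i(h(y))$ for some $h(y)\in X$; and for the map $h:Y\to X$ so obtained (the support map of $T$) there is a partition of $Y$ into clopen subsets $(Y_\alpha)$ such that $h$ is constant on each $Y_\alpha$. -/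

import Mathlib

open scoped ContDiff
open TopologicalSpace
set_option linter.unusedSectionVars false


noncomputable section

variable {G : Type*} [NormedAddCommGroup G] [NormedSpace ℝ G]
variable {H : Type*} [NormedAddCommGroup H] [NormedSpace ℝ H]
variable {E : Type*} [NormedAddCommGroup E] [NormedSpace ℝ E]
variable {F : Type*} [NormedAddCommGroup F] [NormedSpace ℝ F]

/-- Extension by zero to `G` of a function on the open set `X`; since `X` is open, the derivatives
of the extension at points of `X` are those of the function itself. -/
def zeroExt (X : Opens G) (f : X → E) : G → E :=
  Function.extend (Subtype.val : X → G) f 0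

theorem zeroExt_add (X : Opens G) (f g : X → E) :
    zeroExt X (f + g) = zeroExt X f + zeroExt X g := by
  have h := Function.extend_add (Subtype.val : X → G) f g (0 : G → E) 0
  simpa [zeroExt] using h

theorem zeroExt_smul (X : Opens G) (c : ℝ) (f : X → E) :
    zeroExt X (c • f) = c • zeroExt X f := by
  have h := Function.extend_smul c (Subtype.val : X → G) f (0 : G → E)
  simpa [zeroExt] using h

theorem zeroExt_zero (X : Opens G) : zeroExt X (0 : X → E) = 0 := by
  have h := zeroExt_smul X (0 : ℝ) (0 : X → E)
  simpa using h

/-- The functions `X → E` that are infinitely Fréchet differentiable on the open set `X`. -/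
def smoothSubmodule (X : Opens G) (E : Type*) [NormedAddCommGroup E] [NormedSpace ℝ E] :
    Submodule ℝ (X → E) where
  carrier := {f | ContDiffOn ℝ ∞ (zeroExt X f) X}
  add_mem' {f g} hf hg := by
    have h : ContDiffOn ℝ ∞ (zeroExt X f + zeroExt X g) X := ContDiffOn.add hf hg
    rw [← zeroExt_add] at h
    exact h
  zero_mem' := by
    have h : ContDiffOn ℝ ∞ (0 : G → E) X := contDiffOn_const
    rw [← zeroExt_zero] at h
    exact h
  smul_mem' c f hf := by
    have h : ContDiffOn ℝ ∞ (c • zeroExt X f) X := ContDiffOn.const_smul c hf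
    rw [← zeroExt_smul] at h
    exact h

/-- The space `C^∞(X, E)`. It is a type of its own, so that it carries the topology defined below
and not the topology of pointwise convergence. -/
def SmoothFun (X : Opens G) (E : Type*) [NormedAddCommGroup E] [NormedSpace ℝ E] : Type _ :=
  smoothSubmodule X E

namespace SmoothFun

instance instAddCommGroup (X : Opens G) : AddCommGroup (SmoothFun X E) :=
  inferInstanceAs (AddCommGroup (smoothSubmodule X E))

instance instModule (X : Opens G) : Module ℝ (SmoothFun X E) :=
  inferInstanceAs (Module ℝ (smoothSubmodule X E))

instance instCoeFun (X : Opens G) : CoeFun (SmoothFun X E) (fun _ => X → E) where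
  coe f := f.1

/-- The `k`-th Fréchet derivative `D^k f` on `X`. -/
def D {X : Opens G} (k : ℕ) (f : SmoothFun X E) (x : X) : G [×k]→L[ℝ] E :=
  iteratedFDeriv ℝ k (zeroExt X f) x

theorem contDiffAt {X : Opens G} (f : SmoothFun X E) (x : X) :
    ContDiffAt ℝ ∞ (zeroExt X f) x :=
  (f.2 : ContDiffOn ℝ ∞ (zeroExt X f.1) X).contDiffAt (X.isOpen.mem_nhds x.2)

theorem D_add {X : Opens G} (k : ℕ) (f g : SmoothFun X E) (x : X) :
    D k (f + g) x = D k f x + D k g x := by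
  have hk : ((k : ℕ∞) : WithTop ℕ∞) ≤ ∞ := by exact_mod_cast le_top
  have h : zeroExt X (f + g : SmoothFun X E).1 = zeroExt X f.1 + zeroExt X g.1 :=
    zeroExt_add X f.1 g.1
  unfold D
  rw [h]
  exact iteratedFDeriv_add_apply ((f.contDiffAt x).of_le hk) ((g.contDiffAt x).of_le hk)

theorem D_smul {X : Opens G} (k : ℕ) (c : ℝ) (f : SmoothFun X E) (x : X) :
    D k (c • f) x = c • D k f x := by
  have hk : ((k : ℕ∞) : WithTop ℕ∞) ≤ ∞ := by exact_mod_cast le_top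
  have h : zeroExt X (c • f : SmoothFun X E).1 = c • zeroExt X f.1 := zeroExt_smul X c f.1
  unfold D
  rw [h]
  exact iteratedFDeriv_const_smul_apply ((f.contDiffAt x).of_le hk)

theorem continuous_D {X : Opens G} (k : ℕ) (f : SmoothFun X E) : Continuous (D k f) := by
  have hk : ((k : ℕ∞) : WithTop ℕ∞) ≤ ∞ := by exact_mod_cast le_top
  rw [continuous_iff_continuousAt]
  intro x
  have h : ContinuousAt (iteratedFDeriv ℝ k (zeroExt X f)) x :=
    ((f.contDiffAt x).iteratedFDeriv_right (m := 0) (i := k) (by simpa using hk)).continuousAt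
  exact ContinuousAt.comp (f := (Subtype.val : X → G)) h continuous_subtype_val.continuousAt

theorem bddAbove_D {X : Opens G} (K : Compacts X) (k : ℕ) (f : SmoothFun X E) :
    BddAbove (Set.range fun z : K × Fin (k + 1) => ‖D z.2 f z.1‖) := by
  have h : ∀ j : Fin (k + 1), ∃ C : ℝ, ∀ x ∈ (K : Set X), ‖D (j : ℕ) f x‖ ≤ C := fun j =>
    K.isCompact.exists_bound_of_continuousOn (continuous_D (j : ℕ) f).continuousOn
  choose C hC using h
  refine ⟨∑ j, |C j|, ?_⟩
  rintro _ ⟨⟨x, j⟩, rfl⟩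
  exact ((hC j x x.2).trans (le_abs_self _)).trans
    (Finset.single_le_sum (f := fun j => |C j|) (fun i _ => abs_nonneg _) (Finset.mem_univ j))

/-- The seminorm `ρ_{K,k}(f) = sup_{x ∈ K} sup_{0 ≤ j ≤ k} ‖D^j f(x)‖`. -/
def rho (X : Opens G) (E : Type*) [NormedAddCommGroup E] [NormedSpace ℝ E]
    (K : Compacts X) (k : ℕ) : Seminorm ℝ (SmoothFun X E) :=
  Seminorm.of (fun f => ⨆ z : K × Fin (k + 1), ‖D z.2 f z.1‖)
    (by
      intro f g
      refine Real.iSup_le (fun z => ?_) (add_nonneg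
        (Real.iSup_nonneg fun _ => norm_nonneg _) (Real.iSup_nonneg fun _ => norm_nonneg _))
      rw [D_add]
      exact (norm_add_le _ _).trans
        (add_le_add (le_ciSup (bddAbove_D K k f) z) (le_ciSup (bddAbove_D K k g) z)))
    (by
      intro c f
      simp only [D_smul, norm_smul]
      exact (Real.mul_iSup_of_nonneg (norm_nonneg c) _).symm)

/-- The family of all the seminorms `ρ_{K,k}`, `K ⊆ X` compact and `k ∈ ℕ`. -/
def seminorms (X : Opens G) (E : Type*) [NormedAddCommGroup E] [NormedSpace ℝ E] :
    SeminormFamily ℝ (SmoothFun X E) (Compacts X × ℕ) :=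
  fun i => rho X E i.1 i.2

/-- The locally convex topology of `C^∞(X, E)`, generated by the seminorms `ρ_{K,k}`. -/
instance instTopologicalSpace (X : Opens G) : TopologicalSpace (SmoothFun X E) :=
  (seminorms X E).moduleFilterBasis.topology

theorem withSeminorms (X : Opens G) : WithSeminorms (seminorms X E) := ⟨rfl⟩

end SmoothFun

/-- `G` has a smooth bump function all of whose derivatives are bounded. -/
def HasSmoothBump (G : Type*) [NormedAddCommGroup G] [NormedSpace ℝ G] : Prop :=
  ∃ φ : G → ℝ, ContDiff ℝ ∞ φ ∧ (∀ x, ‖x‖ ≤ 1 / 2 → φ x = 1) ∧ (∀ x, 1 ≤ ‖x‖ → φ x = 0) ∧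
    ∀ k : ℕ, ∃ C : ℝ, ∀ x, ‖iteratedFDeriv ℝ k φ x‖ ≤ C

/-- Two functions are disjoint if at every point one of them vanishes. -/
def DisjointFun {X : Opens G} (f g : SmoothFun X E) : Prop :=
  ∀ x, f x = 0 ∨ g x = 0

/-- `T` is separating: it maps disjoint functions to disjoint functions. -/
def IsSeparating {X : Opens G} {Y : Opens H} (T : SmoothFun X E →ₗ[ℝ] SmoothFun Y F) : Prop :=
  ∀ f g, DisjointFun f g → DisjointFun (T f) (T g)

/-- `T` is nowhere trivial: at every point of `Y` some function `T f` does not vanish. -/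
def IsNowhereTrivial {X : Opens G} {Y : Opens H} (T : SmoothFun X E →ₗ[ℝ] SmoothFun Y F) : Prop :=
  ∀ y, ∃ f, T f y ≠ 0

/-- The evaluation map `x ↦ (φ(x))_φ` of `X` into the power of the one-point compactification of
the real line with index set `C^∞(X) = C^∞(X, ℝ)`. -/
def evalMap (X : Opens G) (x : X) : SmoothFun X ℝ → OnePoint ℝ :=
  fun φ => ((φ x : ℝ) : OnePoint ℝ)

/-- The `C^∞(X)`-compactification of `X`: the closure of the image of `X` in this power. -/
abbrev Compactification (X : Opens G) : Type _ :=
  closure (Set.range (evalMap X))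

/-- The canonical map of `X` into its compactification. -/
def toCompactification (X : Opens G) (x : X) : Compactification X :=
  ⟨evalMap X x, subset_closure (Set.mem_range_self x)⟩

/-- The closure in the compactification of `{x ∈ X : f(x) ≠ 0}`. -/
def closedSupport {X : Opens G} (f : SmoothFun X E) : Set (Compactification X) :=
  closure (toCompactification X '' {x | f x ≠ 0})

/-- The family of all open sets `U` of the compactification that contain the closed support of
some `f` with `T f(y) ≠ 0`. -/
def supportNhds {X : Opens G} {Y : Opens H} (T : SmoothFun X E →ₗ[ℝ] SmoothFun Y F) (y : Y) :
    Set (Set (Compactification X)) :=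
  {U | IsOpen U ∧ ∃ f, T f y ≠ 0 ∧ closedSupport f ⊆ U}

/-- `h : Y → X` is the support map of `T` (with `X` regarded as a subset of its compactification):
for every `y`, the point `h y` is the one and only point that lies in the closures of all members
of `supportNhds T y`. -/
def IsSupportMap {X : Opens G} {Y : Opens H} (T : SmoothFun X E →ₗ[ℝ] SmoothFun Y F)
    (h : Y → X) : Prop :=
  ∀ y, ⋂ U ∈ supportNhds T y, closure U = {toCompactification X (h y)}

end

/-!
The image of a neighbourhood of `0` under `T` is bounded, and a neighbourhood of `0` is described
by a single seminorm `ρ_{K,k}`. Hence this one seminorm controls all the seminorms of `T f`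
(`exists_rho_bound`): `T` depends on derivatives of order at most `k` on one compact set `K`, but it
produces functions whose derivatives of every order are controlled.

By compactness of `K`, for each `y` there is a point `h y` such that functions carried by
arbitrarily small neighbourhoods of `h y` have `T f (y) ≠ 0` (`exists_isSupportPoint`). As `T` is
separating, a function that vanishes near `h y` is mapped to a function that vanishes near `y`
(`IsSupportPoint.eventually_eq_zero`). This identifies the intersection of the closures of the
members of `supportNhds T y`, because the compactification is a regular space
(`IsSupportPoint.iInter_closure_eq`).

To see that `h` is locally constant, let `a` and `b` be close to a point where `T f ≠ 0`, and
multiply `f` by a bump of radius `r < ‖h a - h b‖` around `h a`. The product `g` has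
`ρ_{K,k}(g) = O(r⁻ᵏ)`, while `T g (a) = T f (a)` is bounded away from zero and `T g` vanishes near
`b`. Taylor's formula of order `2k` at `b` gives `1 = O(r⁻ᵏ ‖a - b‖²ᵏ)`, that is, `r = O(‖a - b‖²)`
(`exists_min_dist_le_sq`). So `h` has derivative zero along segments.
-/

open Filter Topology Set

section Smooth

variable {G : Type*} [NormedAddCommGroup G] [NormedSpace ℝ G]
variable {H : Type*} [NormedAddCommGroup H] [NormedSpace ℝ H]
variable {E : Type*} [NormedAddCommGroup E] [NormedSpace ℝ E]
variable {F : Type*} [NormedAddCommGroup F] [NormedSpace ℝ F]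

/-! ### Smooth functions and their seminorms -/

theorem zeroExt_coe (X : Opens G) (f : X → E) (x : X) : zeroExt X f x = f x :=
  Subtype.val_injective.extend_apply f 0 x

namespace SmoothFun

variable {X : Opens G}

@[simp] theorem sub_apply (f g : SmoothFun X E) (x : X) : (f - g) x = f x - g x := rfl

theorem continuous (f : SmoothFun X E) : Continuous (f : X → E) := by
  rw [continuous_iff_continuousAt]
  intro x
  have h : ContinuousAt (zeroExt X f.1 ∘ (Subtype.val : X → G)) x :=
    (f.contDiffAt x).continuousAt.comp continuous_subtype_val.continuousAt
  exact h.congr (Eventually.of_forall fun z => zeroExt_coe X f.1 z)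

theorem norm_D_zero (f : SmoothFun X E) (x : X) : ‖D 0 f x‖ = ‖f x‖ := by
  rw [D, norm_iteratedFDeriv_zero, zeroExt_coe]

theorem D_eq_zero_of_eventually {f : SmoothFun X E} {x : X} (hf : ∀ᶠ z in 𝓝 x, f z = 0) (j : ℕ) :
    D j f x = 0 := by
  have h : zeroExt X f.1 =ᶠ[𝓝 (x : G)] (0 : G → E) := by
    rw [← map_nhds_subtype_coe_eq_nhds x.2 (X.isOpen.mem_nhds x.2)]
    exact hf.mono fun z hz => (zeroExt_coe X f.1 z).trans hz
  rw [D, (h.iteratedFDeriv ℝ j).eq_of_nhds]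
  simp

theorem norm_D_le_rho {K : Compacts X} {k j : ℕ} (hj : j ≤ k) (f : SmoothFun X E) {x : X}
    (hx : x ∈ K) : ‖D j f x‖ ≤ rho X E K k f :=
  le_ciSup (bddAbove_D K k f) (⟨x, hx⟩, ⟨j, Nat.lt_succ_of_le hj⟩)

theorem rho_le {K : Compacts X} {k : ℕ} {f : SmoothFun X E} {M : ℝ} (hM : 0 ≤ M)
    (h : ∀ x ∈ K, ∀ j ≤ k, ‖D j f x‖ ≤ M) : rho X E K k f ≤ M :=
  Real.iSup_le (fun z => h z.1 z.1.2 z.2 (Nat.le_of_lt_succ z.2.2)) hM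

theorem rho_mono {K K' : Compacts X} {k k' : ℕ} (hK : K ≤ K') (hk : k ≤ k') :
    rho X E K k ≤ rho X E K' k' := fun f =>
  rho_le (apply_nonneg _ f) fun _ hx _ hj => norm_D_le_rho (hj.trans hk) f (hK hx)

/-- The product of a function in `C^∞(X, E)` with a smooth scalar function defined on all of `G`. -/
def cutoff (ψ : G → ℝ) (hψ : ContDiff ℝ ∞ ψ) (f : SmoothFun X E) : SmoothFun X E :=
  ⟨fun x => ψ x • f x, by
    have h : ContDiffOn ℝ ∞ (fun z => ψ z • zeroExt X f.1 z) X := hψ.contDiffOn.smul f.2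
    exact h.congr fun z hz => by
      rw [zeroExt_coe X _ ⟨z, hz⟩, zeroExt_coe X f.1 ⟨z, hz⟩]⟩

@[simp] theorem cutoff_apply (ψ : G → ℝ) (hψ : ContDiff ℝ ∞ ψ) (f : SmoothFun X E) (x : X) :
    cutoff ψ hψ f x = ψ x • f x := rfl

theorem norm_D_cutoff_le (ψ : G → ℝ) (hψ : ContDiff ℝ ∞ ψ) (f : SmoothFun X E) (x : X) (n : ℕ) :
    ‖D n (cutoff ψ hψ f) x‖ ≤ ∑ i ∈ Finset.range (n + 1),
      (n.choose i : ℝ) * ‖iteratedFDeriv ℝ i ψ x‖ * ‖D (n - i) f x‖ := by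
  have hX := X.isOpen
  have hn : ((n : ℕ∞) : WithTop ℕ∞) ≤ ∞ := by exact_mod_cast le_top
  have h := norm_iteratedFDerivWithin_smul_le (𝕜 := ℝ) (f := ψ) (g := zeroExt X f.1)
    hψ.contDiffOn f.2 hX.uniqueDiffOn x.2 hn
  have hz : zeroExt X (cutoff ψ hψ f).1 =ᶠ[𝓝 (x : G)] fun z => ψ z • zeroExt X f.1 z := by
    filter_upwards [hX.mem_nhds x.2] with z hz
    rw [zeroExt_coe X _ ⟨z, hz⟩, zeroExt_coe X f.1 ⟨z, hz⟩]
    rfl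
  rw [D, (hz.iteratedFDeriv ℝ n).eq_of_nhds]
  simp only [iteratedFDerivWithin_of_isOpen _ hX x.2] at h
  exact h

end SmoothFun

/-- A smooth bump around any centre `c` and of any radius `r ≤ 1` can be chosen such that
multiplication by it costs at most a factor `A r⁻ᵏ` in the seminorm `ρ_{K,k}`. -/
theorem exists_cutoff_rho_le (hG : HasSmoothBump G) {X : Opens G} (K : Compacts X) (k : ℕ)
    (f : SmoothFun X E) : ∃ A : ℝ, 0 ≤ A ∧ ∀ (c : G) (r : ℝ), 0 < r → r ≤ 1 →
      ∃ (ψ : G → ℝ) (hψ : ContDiff ℝ ∞ ψ), (∀ z, ‖z - c‖ ≤ r / 2 → ψ z = 1) ∧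
        (∀ z, r ≤ ‖z - c‖ → ψ z = 0) ∧
        SmoothFun.rho X E K k (SmoothFun.cutoff ψ hψ f) ≤ A * r⁻¹ ^ k := by
  obtain ⟨φ, hφ, hφ1, hφ0, hb⟩ := hG
  choose B hB using hb
  have hB0 : ∀ i, 0 ≤ B i := fun i => (norm_nonneg _).trans (hB i 0)
  set R := SmoothFun.rho X E K k f
  have hR0 : 0 ≤ R := apply_nonneg _ _
  set S : ℕ → ℝ := fun n => ∑ i ∈ Finset.range (n + 1), (n.choose i : ℝ) * B i * R with hS
  have hS0 : ∀ n, 0 ≤ S n := fun n => Finset.sum_nonneg fun i _ => by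
    have := hB0 i; positivity
  refine ⟨∑ n ∈ Finset.range (k + 1), S n, Finset.sum_nonneg fun n _ => hS0 n, ?_⟩
  intro c r hr hr1
  have hri : 1 ≤ r⁻¹ := (one_le_inv₀ hr).2 hr1
  have hψ : ContDiff ℝ ∞ fun z => φ (r⁻¹ • (z - c)) :=
    hφ.comp ((contDiff_id.sub contDiff_const).const_smul r⁻¹)
  have hnorm : ∀ z, ‖r⁻¹ • (z - c)‖ = ‖z - c‖ / r := fun z => by
    rw [norm_smul, norm_inv, Real.norm_of_nonneg hr.le, div_eq_inv_mul]
  refine ⟨fun z => φ (r⁻¹ • (z - c)), hψ, fun z hz => hφ1 _ ?_, fun z hz => hφ0 _ ?_, ?_⟩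
  · rw [hnorm, div_le_iff₀ hr]; linarith
  · rw [hnorm, le_div_iff₀ hr]; linarith
  refine SmoothFun.rho_le ?_ fun x hx n hn => ?_
  · have := Finset.sum_nonneg fun n (_ : n ∈ Finset.range (k + 1)) => hS0 n
    positivity
  have hder : ∀ i ≤ k, ‖iteratedFDeriv ℝ i (fun z => φ (r⁻¹ • (z - c))) x‖ ≤ r⁻¹ ^ k * B i := by
    intro i hi
    have h1 : iteratedFDeriv ℝ i (fun z => φ (r⁻¹ • (z - c))) x =
        r⁻¹ ^ i • iteratedFDeriv ℝ i φ (r⁻¹ • ((x : G) - c)) := by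
      rw [iteratedFDeriv_comp_sub (f := fun z => φ (r⁻¹ • z)) i c (x : G),
        iteratedFDeriv_comp_const_smul r⁻¹ (hφ.of_le (by exact_mod_cast le_top))]
    rw [h1, norm_smul, Real.norm_of_nonneg (by positivity)]
    exact mul_le_mul (pow_le_pow_right₀ hri hi) (hB i _) (norm_nonneg _) (by positivity)
  calc _ ≤ _ := SmoothFun.norm_D_cutoff_le _ hψ f x n
    _ ≤ ∑ i ∈ Finset.range (n + 1), (n.choose i : ℝ) * (r⁻¹ ^ k * B i) * R := by
      refine Finset.sum_le_sum fun i hi => ?_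
      have hi' : i ≤ n := Nat.le_of_lt_succ (Finset.mem_range.1 hi)
      have h1 := hder i (hi'.trans hn)
      have h2 : ‖SmoothFun.D (n - i) f x‖ ≤ R :=
        SmoothFun.norm_D_le_rho ((Nat.sub_le n i).trans hn) f hx
      have := hB0 i
      gcongr
    _ = S n * r⁻¹ ^ k := by
      rw [hS, Finset.sum_mul]
      exact Finset.sum_congr rfl fun i _ => by ring
    _ ≤ (∑ n ∈ Finset.range (k + 1), S n) * r⁻¹ ^ k := by
      gcongr
      exact Finset.single_le_sum (f := S) (fun i _ => hS0 i)
        (Finset.mem_range.2 (Nat.lt_succ_of_le hn))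

/-- A smooth function all of whose derivatives vanish at `b` is `O(‖z - b‖ⁿ)` on a convex set, with
constant the supremum of its `n`-th derivative there. -/
theorem norm_le_of_iteratedFDeriv_eq_zero {u : H → F} {S : Set H} (hS : Convex ℝ S)
    (hu : ∀ z ∈ S, ContDiffAt ℝ ∞ u z) {b : H} (hbS : b ∈ S)
    (hb : ∀ j, iteratedFDeriv ℝ j u b = 0) {M : ℝ} {n : ℕ}
    (hM : ∀ z ∈ S, ‖iteratedFDeriv ℝ n u z‖ ≤ M) {a : H} (ha : a ∈ S) :
    ‖u a‖ ≤ M * ‖a - b‖ ^ n := by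
  have key : ∀ m j, (∀ z ∈ S, ‖iteratedFDeriv ℝ (j + m) u z‖ ≤ M) →
      ∀ z ∈ S, ‖iteratedFDeriv ℝ j u z‖ ≤ M * ‖z - b‖ ^ m := by
    intro m
    induction m with
    | zero => intro j h z hz; simpa using h z hz
    | succ m ih =>
      intro j h z hz
      have ih' := ih (j + 1) (by rwa [show j + 1 + m = j + (m + 1) by omega])
      have hsub : segment ℝ b z ⊆ S := hS.segment_subset hbS hz
      have hM0 : 0 ≤ M := (norm_nonneg _).trans (h z hz)
      have h1 := (convex_segment b z).norm_image_sub_le_of_norm_hasFDerivWithin_le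
        (𝕜 := ℝ) (f := iteratedFDeriv ℝ j u) (f' := fderiv ℝ (iteratedFDeriv ℝ j u))
        (C := M * ‖z - b‖ ^ m)
        (fun w hw => ((hu w (hsub hw)).differentiableAt_iteratedFDeriv
          (by exact_mod_cast WithTop.coe_lt_top j)).hasFDerivAt.hasFDerivWithinAt)
        (fun w hw => by
          rw [norm_fderiv_iteratedFDeriv]
          refine (ih' w (hsub hw)).trans ?_
          have : ‖w - b‖ ≤ ‖z - b‖ := norm_sub_le_of_mem_segment hw
          gcongr)
        (left_mem_segment ℝ b z) (right_mem_segment ℝ b z)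
      rw [hb j, sub_zero] at h1
      rw [pow_succ, ← mul_assoc]
      exact h1
  have := key n 0 (by rwa [zero_add]) a ha
  rwa [norm_iteratedFDeriv_zero] at this

/-! ### Operators bounded on an open set -/

/-- If a linear operator maps some non-empty open set onto a bounded set, then all seminorms of
`T f` are controlled by one and the same seminorm of `f`. -/
theorem exists_rho_bound {X : Opens G} {Y : Opens H} (T : SmoothFun X E →ₗ[ℝ] SmoothFun Y F)
    (hbdd : ∃ U : Set (SmoothFun X E), IsOpen U ∧ U.Nonempty ∧
      Bornology.IsVonNBounded ℝ (T '' U)) :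
    ∃ (K : Compacts X) (k : ℕ), 1 ≤ k ∧ ∀ (L : Compacts Y) (l : ℕ), ∃ C : ℝ, 0 ≤ C ∧
      ∀ f, SmoothFun.rho Y F L l (T f) ≤ C * SmoothFun.rho X E K k f := by
  obtain ⟨U, hU, ⟨f₀, hf₀⟩, hb⟩ := hbdd
  obtain ⟨s, ε, hε, hs⟩ := ((SmoothFun.withSeminorms X).isOpen_iff_mem_balls U).1 hU f₀ hf₀
  refine ⟨s.sup Prod.fst, s.sup Prod.snd + 1, by omega, fun L l => ?_⟩
  set p := SmoothFun.rho X E (s.sup Prod.fst) (s.sup Prod.snd + 1)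
  obtain ⟨r, hr, hrb⟩ :=
    ((SmoothFun.withSeminorms Y).isVonNBounded_iff_seminorm_bounded.1 hb) (L, l)
  set q := SmoothFun.rho Y F L l
  have hle : s.sup (SmoothFun.seminorms X E) ≤ p := Finset.sup_le fun i hi =>
    SmoothFun.rho_mono (Finset.le_sup (f := Prod.fst) hi)
      ((Finset.le_sup (f := Prod.snd) hi).trans (Nat.le_succ _))
  have hball : ∀ f, p f < ε → q (T f) ≤ 2 * r := by
    intro f hf
    have h0 : q (T f₀) < r := hrb _ ⟨f₀, hf₀, rfl⟩
    have h1 : q (T (f₀ + f)) < r := hrb _ ⟨f₀ + f, hs (by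
      rw [Seminorm.mem_ball, add_sub_cancel_left]
      exact (hle f).trans_lt hf), rfl⟩
    have h2 : q (T (f₀ + f) - T f₀) ≤ q (T (f₀ + f)) + q (T f₀) := map_sub_le_add q _ _
    rw [map_add, add_sub_cancel_left] at h2
    rw [map_add] at h1
    linarith
  refine ⟨2 * r * (2 / ε), by positivity, fun f => ?_⟩
  have hscale : ∀ M, p f < M → q (T f) ≤ 2 * r * (1 / ε) * M := by
    intro M hM
    have hM0 : 0 < M := (apply_nonneg p f).trans_lt hM
    have h := hball ((ε / M) • f) (by
      rw [map_smul_eq_mul, Real.norm_of_nonneg (by positivity), div_mul_eq_mul_div,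
        div_lt_iff₀ hM0]
      exact mul_lt_mul_of_pos_left hM hε)
    rw [map_smul, map_smul_eq_mul, Real.norm_of_nonneg (by positivity), div_mul_eq_mul_div,
      div_le_iff₀ hM0] at h
    rw [mul_one_div, div_mul_eq_mul_div, le_div_iff₀ hε]
    linarith
  rcases (apply_nonneg p f).eq_or_lt with h0 | h0
  · rw [← h0, mul_zero]
    refine le_of_forall_pos_le_add fun η hη => ?_
    have h := hscale (η / (2 * r * (1 / ε))) (by rw [← h0]; positivity)
    rw [mul_div_cancel₀ _ (by positivity)] at h
    linarith
  · have h := hscale (2 * p f) (by linarith)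
    calc q (T f) ≤ _ := h
      _ = _ := by ring

/-! ### Support points -/

/-- `x` is a support point of `T` at `y`: every neighbourhood of `x` carries a function `f` with
`T f (y) ≠ 0`. -/
def IsSupportPoint {X : Opens G} {Y : Opens H} (T : SmoothFun X E →ₗ[ℝ] SmoothFun Y F)
    (y : Y) (x : X) : Prop :=
  ∀ V ∈ 𝓝 x, ∃ f, T f y ≠ 0 ∧ ∀ z ∉ V, f z = 0

section Operator

variable {X : Opens G} {Y : Opens H} {T : SmoothFun X E →ₗ[ℝ] SmoothFun Y F}

/-- Near `y` the function `T f` does not see `f` away from a support point of `T` at `y`: a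
function `g` carried by the zero set of `f` with `T g (y) ≠ 0` has `T g ≠ 0` on a whole
neighbourhood of `y`, and `T f` is disjoint from `T g`. -/
theorem IsSupportPoint.eventually_eq_zero {y : Y} {x : X} (hx : IsSupportPoint T y x)
    (hsep : IsSeparating T) {f : SmoothFun X E} (hf : ∀ᶠ z in 𝓝 x, f z = 0) :
    ∀ᶠ y' in 𝓝 y, T f y' = 0 := by
  obtain ⟨g, hg, hg0⟩ := hx _ hf
  have hd : DisjointFun f g := fun z => (em (f z = 0)).imp id (hg0 z)
  filter_upwards [(T g).continuous.continuousAt.eventually_ne hg] with y' hy'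
  exact (hsep f g hd y').resolve_right hy'

theorem IsSupportPoint.apply_eq {y : Y} {x : X} (hx : IsSupportPoint T y x)
    (hsep : IsSeparating T) {f g : SmoothFun X E} (hfg : ∀ᶠ z in 𝓝 x, f z = g z) :
    T f y = T g y := by
  have h : T (f - g) y = 0 :=
    (hx.eventually_eq_zero hsep (f := f - g) (hfg.mono fun z hz => by simp [hz])).self_of_nhds
  rwa [map_sub, SmoothFun.sub_apply, sub_eq_zero] at h

/-- If no point of the compact set `K` were a support point at `y`, then cutting `f` off near
finitely many points of `K` would leave `T f (y)` unchanged and make `f` vanish near `K`. -/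
theorem exists_isSupportPoint (hG : HasSmoothBump G) (hnt : IsNowhereTrivial T) {K : Compacts X}
    {k : ℕ} (hT : ∀ (L : Compacts Y) (l : ℕ), ∃ C : ℝ, 0 ≤ C ∧
      ∀ f, SmoothFun.rho Y F L l (T f) ≤ C * SmoothFun.rho X E K k f) (y : Y) :
    ∃ x, IsSupportPoint T y x := by
  by_contra hno
  have hno' : ∀ x : X, ∃ V ∈ 𝓝 x, ∀ f, (∀ z ∉ V, f z = 0) → T f y = 0 := by
    intro x
    have := not_exists.1 hno x
    unfold IsSupportPoint at this
    push Not at this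
    obtain ⟨V, hV, h⟩ := this
    refine ⟨V, hV, fun f hf => by_contra fun hne => ?_⟩
    obtain ⟨z, hz, hfz⟩ := h f hne
    exact hfz (hf z hz)
  -- Cutting off preserves zeros, so that finitely many cut-offs can be made one after another.
  have hcov : ∀ f : SmoothFun X E, ∃ g : SmoothFun X E, T g y = T f y ∧
      (∀ z, f z = 0 → g z = 0) ∧ ∀ᶠ z in 𝓝ˢ (K : Set X), g z = 0 := by
    refine K.isCompact.induction_on (p := fun s => ∀ f : SmoothFun X E, ∃ g : SmoothFun X E,
      T g y = T f y ∧ (∀ z, f z = 0 → g z = 0) ∧ ∀ᶠ z in 𝓝ˢ s, g z = 0) ?_ ?_ ?_ ?_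
    · exact fun f => ⟨f, rfl, fun z hz => hz, by simp⟩
    · intro s t hst ht f
      obtain ⟨g, h1, h2, h3⟩ := ht f
      exact ⟨g, h1, h2, h3.filter_mono (nhdsSet_mono hst)⟩
    · intro s t hs ht f
      obtain ⟨g, h1, h2, h3⟩ := hs f
      obtain ⟨g', h1', h2', h3'⟩ := ht g
      refine ⟨g', h1'.trans h1, fun z hz => h2' z (h2 z hz), ?_⟩
      rw [nhdsSet_union, eventually_sup]
      exact ⟨h3.mono h2', h3'⟩
    · intro x _
      obtain ⟨V, hV, hV0⟩ := hno' x
      obtain ⟨ρ, hρ, hρV⟩ := Metric.mem_nhds_iff.1 hV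
      set r := min ρ 1
      have hr : 0 < r := lt_min hρ one_pos
      have hball : IsOpen (Metric.ball x (r / 2)) := Metric.isOpen_ball
      refine ⟨Metric.ball x (r / 2), mem_nhdsWithin_of_mem_nhds
        (Metric.ball_mem_nhds x (by positivity)), fun f => ?_⟩
      obtain ⟨_, -, hA⟩ := exists_cutoff_rho_le hG K k f
      obtain ⟨ψ, hψ, hψ1, hψ0, -⟩ := hA x r hr (min_le_right _ _)
      refine ⟨f - SmoothFun.cutoff ψ hψ f, ?_, fun z hz => by simp [hz], ?_⟩
      · have : T (SmoothFun.cutoff ψ hψ f) y = 0 := hV0 _ fun z hz => by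
          have hz' : r ≤ ‖(z : G) - x‖ := by
            by_contra hlt
            refine hz (hρV (Metric.mem_ball.2 ?_))
            rw [Subtype.dist_eq, dist_eq_norm]
            exact (not_le.1 hlt).trans_le (min_le_left _ _)
          simp [hψ0 z hz']
        rw [map_sub, SmoothFun.sub_apply, this, sub_zero]
      · rw [hball.nhdsSet_eq, eventually_principal]
        intro z hz
        have hz' : ‖(z : G) - x‖ ≤ r / 2 := by
          rw [Metric.mem_ball, Subtype.dist_eq, dist_eq_norm] at hz
          exact hz.le
        simp [hψ1 z hz']
  obtain ⟨f, hf⟩ := hnt y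
  obtain ⟨g, hgf, -, hg⟩ := hcov f
  have hrho : SmoothFun.rho X E K k g = 0 := le_antisymm
    (SmoothFun.rho_le le_rfl fun x hx j _ => by
      rw [SmoothFun.D_eq_zero_of_eventually (eventually_nhdsSet_iff_forall.1 hg x hx), norm_zero])
    (apply_nonneg _ _)
  obtain ⟨C, -, hC⟩ := hT ⟨{y}, isCompact_singleton⟩ 0
  have h1 := hC g
  rw [hrho, mul_zero] at h1
  have h2 := (SmoothFun.norm_D_le_rho (K := (⟨{y}, isCompact_singleton⟩ : Compacts Y)) le_rfl
    (T g) rfl).trans h1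
  rw [SmoothFun.norm_D_zero, hgf] at h2
  exact hf (norm_le_zero_iff.1 h2)

/-! ### The support map is locally constant -/

/-- Along a convex compact set on which `T f` is bounded away from zero, the support map is locally
Hölder continuous of exponent `2`. -/
theorem exists_min_dist_le_sq (hG : HasSmoothBump G) (hsep : IsSeparating T) {K : Compacts X}
    {k : ℕ} (hk : 1 ≤ k) (hT : ∀ (L : Compacts Y) (l : ℕ), ∃ C : ℝ, 0 ≤ C ∧
      ∀ f, SmoothFun.rho Y F L l (T f) ≤ C * SmoothFun.rho X E K k f)
    {h : Y → X} (hh : ∀ y, IsSupportPoint T y (h y)) {S : Set H} (hSc : IsCompact S)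
    (hS : Convex ℝ S) (hSY : S ⊆ Y) {f : SmoothFun X E} {δ : ℝ} (hδ : 0 < δ)
    (hf : ∀ y : Y, (y : H) ∈ S → δ ≤ ‖T f y‖) :
    ∃ C : ℝ, 0 ≤ C ∧ ∀ a b : Y, (a : H) ∈ S → (b : H) ∈ S →
      min (‖(h b : G) - h a‖ / 2) 1 ≤ C * ‖(a : H) - b‖ ^ 2 := by
  let L : Compacts Y := ⟨Subtype.val ⁻¹' S, by
    rw [Subtype.isCompact_iff, image_preimage_eq_of_subset (by simpa using hSY)]
    exact hSc⟩
  -- The order `2 k` outweighs the factor `r⁻ᵏ` of a bump of radius `r`.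
  obtain ⟨C₀, hC₀, hTC⟩ := hT L (2 * k)
  obtain ⟨A, hA, hcut⟩ := exists_cutoff_rho_le hG K k f
  set C := max 1 (C₀ * A / δ)
  have hC1 : 1 ≤ C := le_max_left _ _
  refine ⟨C, by positivity, fun a b ha hb => ?_⟩
  rcases (norm_nonneg ((h b : G) - h a)).eq_or_lt with h0 | hpos
  · rw [← h0, zero_div, min_eq_left zero_le_one]
    positivity
  set r := min (‖(h b : G) - h a‖ / 2) 1
  have hr0 : 0 < r := lt_min (by positivity) one_pos
  have hrlt : r < ‖(h b : G) - h a‖ := (min_le_left _ _).trans_lt (by linarith)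
  obtain ⟨ψ, hψ, hψ1, hψ0, hrho⟩ := hcut (h a) r hr0 (min_le_right _ _)
  set g := SmoothFun.cutoff ψ hψ f with hg
  have hcont : Continuous fun z : X => ‖(z : G) - h a‖ := by fun_prop
  have hga : T g a = T f a := by
    refine (hh a).apply_eq hsep ?_
    filter_upwards [hcont.continuousAt.eventually_lt_const
      (show ‖(h a : G) - h a‖ < r / 2 by simpa using hr0)] with z hz
    rw [hg, SmoothFun.cutoff_apply, hψ1 z hz.le, one_smul]
  have hgb : ∀ᶠ y in 𝓝 b, T g y = 0 := by
    refine (hh b).eventually_eq_zero hsep ?_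
    filter_upwards [hcont.continuousAt.eventually_const_lt hrlt] with z hz
    rw [hg, SmoothFun.cutoff_apply, hψ0 z hz.le, zero_smul]
  have htaylor := norm_le_of_iteratedFDeriv_eq_zero (u := zeroExt Y (T g).1) (n := 2 * k) hS
    (fun z hz => (T g).contDiffAt ⟨z, hSY hz⟩) hb
    (fun j => SmoothFun.D_eq_zero_of_eventually hgb j)
    (fun z hz => SmoothFun.norm_D_le_rho (K := L) le_rfl (T g) (x := ⟨z, hSY hz⟩) hz) ha
  rw [zeroExt_coe, hga] at htaylor
  have h1 : δ ≤ C₀ * (A * r⁻¹ ^ k) * ‖(a : H) - b‖ ^ (2 * k) :=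
    (hf a ha).trans (htaylor.trans (by
      gcongr
      exact (hTC g).trans (by gcongr)))
  have h2 : r ^ k ≤ (C * ‖(a : H) - b‖ ^ 2) ^ k := by
    have h3 : r ^ k ≤ C₀ * A / δ * ‖(a : H) - b‖ ^ (2 * k) := by
      rw [div_mul_eq_mul_div, le_div_iff₀ hδ]
      calc r ^ k * δ ≤ r ^ k * (C₀ * (A * r⁻¹ ^ k) * ‖(a : H) - b‖ ^ (2 * k)) := by gcongr
        _ = C₀ * A * ‖(a : H) - b‖ ^ (2 * k) := by
          rw [show r ^ k * (C₀ * (A * r⁻¹ ^ k) * ‖(a : H) - b‖ ^ (2 * k)) =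
            C₀ * A * ‖(a : H) - b‖ ^ (2 * k) * (r * r⁻¹) ^ k by rw [mul_pow]; ring,
            mul_inv_cancel₀ hr0.ne', one_pow, mul_one]
    rw [mul_pow, ← pow_mul]
    refine h3.trans ?_
    gcongr
    exact (le_max_right _ _).trans (le_self_pow₀ hC1 (by omega))
  exact (pow_le_pow_iff_left₀ hr0.le (by positivity) (by omega)).1 h2

theorem isLocallyConstant_of_isSupportPoint (hG : HasSmoothBump G) (hsep : IsSeparating T)
    (hnt : IsNowhereTrivial T) {K : Compacts X}
    {k : ℕ} (hk : 1 ≤ k) (hT : ∀ (L : Compacts Y) (l : ℕ), ∃ C : ℝ, 0 ≤ C ∧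
      ∀ f, SmoothFun.rho Y F L l (T f) ≤ C * SmoothFun.rho X E K k f)
    {h : Y → X} (hh : ∀ y, IsSupportPoint T y (h y)) : IsLocallyConstant h := by
  rw [IsLocallyConstant.iff_eventually_eq]
  intro y₀
  obtain ⟨f, hf⟩ := hnt y₀
  have hδ : 0 < ‖T f y₀‖ / 2 := half_pos (norm_pos_iff.2 hf)
  have hev : ∀ᶠ y in 𝓝 y₀, ‖T f y₀‖ / 2 < ‖T f y‖ :=
    (T f).continuous.norm.continuousAt.eventually_const_lt (half_lt_self (norm_pos_iff.2 hf))
  have hev' : ∀ᶠ z in 𝓝 (y₀ : H), ∃ hz : z ∈ Y, ‖T f y₀‖ / 2 < ‖T f ⟨z, hz⟩‖ := by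
    rw [← map_nhds_subtype_coe_eq_nhds y₀.2 (Y.isOpen.mem_nhds y₀.2)]
    exact hev.mono fun z hz => ⟨z.2, hz⟩
  obtain ⟨ρ, hρ, hball⟩ := Metric.eventually_nhds_iff_ball.1 hev'
  filter_upwards [Metric.ball_mem_nhds y₀ hρ] with y₁ hy₁
  have hsub : segment ℝ (y₀ : H) y₁ ⊆ Metric.ball (y₀ : H) ρ :=
    (convex_ball _ _).segment_subset (Metric.mem_ball_self hρ) hy₁
  have hSY : segment ℝ (y₀ : H) y₁ ⊆ Y := fun z hz => (hball z (hsub hz)).1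
  obtain ⟨C, hC, hb⟩ := exists_min_dist_le_sq hG hsep hk hT hh (by
      rw [segment_eq_image_lineMap]
      exact isCompact_Icc.image AffineMap.lineMap_continuous)
    (convex_segment _ _) hSY hδ fun y hy => (hball y (hsub hy)).2.le
  let e : H → G := Function.extend (Subtype.val : Y → H) (fun y => (h y : G)) 0
  have he : ∀ y : Y, e y = h y := Subtype.val_injective.extend_apply _ _
  have hder : ∀ z ∈ segment ℝ (y₀ : H) y₁,
      HasFDerivWithinAt e (0 : H →L[ℝ] G) (segment ℝ (y₀ : H) y₁) z := by
    intro z hz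
    rw [← hasFDerivWithinAt_sub_const_iff (e z)]
    refine Asymptotics.IsBigO.hasFDerivWithinAt (n := 2) ?_ hz one_lt_two
    refine Asymptotics.IsBigO.of_bound (2 * C) ?_
    have hsmall : ∀ᶠ w in 𝓝 z, C * ‖z - w‖ ^ 2 < 1 := by
      have hc : Continuous fun w => C * ‖z - w‖ ^ 2 := by fun_prop
      exact hc.continuousAt.eventually_lt_const (by simp)
    filter_upwards [self_mem_nhdsWithin, mem_nhdsWithin_of_mem_nhds hsmall] with w hw hw1
    have h1 := hb ⟨z, hSY hz⟩ ⟨w, hSY hw⟩ hz hw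
    rw [← he ⟨z, hSY hz⟩, ← he ⟨w, hSY hw⟩] at h1
    have h2 := (min_le_iff.1 h1).resolve_right (not_le.2 hw1)
    rw [norm_pow, norm_norm, norm_sub_rev w z]
    linarith
  have := (convex_segment (y₀ : H) y₁).norm_image_sub_le_of_norm_hasFDerivWithin_le (𝕜 := ℝ)
    (C := 0) hder (fun _ _ => by simp) (left_mem_segment ℝ _ _) (right_mem_segment ℝ _ _)
  rw [he, he, zero_mul, norm_le_zero_iff, sub_eq_zero] at this
  exact Subtype.ext this

/-! ### The support set in the compactification -/

theorem continuous_toCompactification (X : Opens G) : Continuous (toCompactification X) :=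
  Continuous.subtype_mk (continuous_pi fun φ =>
    OnePoint.continuous_coe.comp (SmoothFun.continuous φ)) _

theorem IsSupportPoint.iInter_closure_eq {y : Y} {x : X} (hx : IsSupportPoint T y x)
    (hsep : IsSeparating T) :
    ⋂ U ∈ supportNhds T y, closure U = {toCompactification X x} := by
  have hi := continuous_toCompactification X
  ext p
  simp only [mem_iInter, mem_singleton_iff]
  constructor
  · intro hp
    by_contra hne
    -- The compactification is regular: `p` lies outside some closed neighbourhood of `i x`.
    obtain ⟨V, hV, hVc, hVp⟩ := exists_mem_nhds_isClosed_subset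
      (isOpen_compl_singleton.mem_nhds (Ne.symm hne) : {p}ᶜ ∈ 𝓝 (toCompactification X x))
    obtain ⟨W, hW, hWc, hWV⟩ := exists_mem_nhds_isClosed_subset (interior_mem_nhds.2 hV)
    obtain ⟨f, hf, hf0⟩ := hx _ (hi.continuousAt.preimage_mem_nhds hW)
    have hfW : closedSupport f ⊆ W := by
      refine closure_minimal ?_ hWc
      rintro _ ⟨z, hz, rfl⟩
      by_contra hzW
      exact hz (hf0 z hzW)
    exact hVp (closure_minimal interior_subset hVc
      (hp _ ⟨isOpen_interior, f, hf, hfW.trans hWV⟩)) rfl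
  · rintro rfl U ⟨-, f, hf, hfU⟩
    refine subset_closure (hfU ?_)
    have hxf : x ∈ closure {z | f z ≠ 0} := by
      rw [mem_closure_iff_frequently]
      exact fun hev => hf (hx.eventually_eq_zero hsep
        (hev.mono fun z hz => not_not.1 hz)).self_of_nhds
    exact image_closure_subset_closure_image hi (mem_image_of_mem _ hxf)

end Operator

end Smooth

theorem theorem18
    {G : Type*} [NormedAddCommGroup G] [NormedSpace ℝ G] [CompleteSpace G]
    {H : Type*} [NormedAddCommGroup H] [NormedSpace ℝ H] [CompleteSpace H]
    {E : Type*} [NormedAddCommGroup E] [NormedSpace ℝ E] [CompleteSpace E]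
    {F : Type*} [NormedAddCommGroup F] [NormedSpace ℝ F] [CompleteSpace F]
    (hG : HasSmoothBump G)
    (X : TopologicalSpace.Opens G) (Y : TopologicalSpace.Opens H)
    (T : SmoothFun X E →ₗ[ℝ] SmoothFun Y F)
    (hsep : IsSeparating T) (hnt : IsNowhereTrivial T)
    (hbdd : ∃ U : Set (SmoothFun X E), IsOpen U ∧ U.Nonempty ∧
      Bornology.IsVonNBounded ℝ (T '' U)) :
    ∃ h : Y → X, IsSupportMap T h ∧
      ∃ P : Set (Set Y), Setoid.IsPartition P ∧
        ∀ A ∈ P, IsClopen A ∧ ∃ x : X, ∀ y ∈ A, h y = x := by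
  obtain ⟨K, k, hk, hT⟩ := exists_rho_bound T hbdd
  choose h hh using exists_isSupportPoint hG hnt hT
  refine ⟨h, fun y => (hh y).iInter_closure_eq hsep, (Setoid.ker h).classes,
    Setoid.isPartition_classes _, ?_⟩
  rintro _ ⟨y, rfl⟩
  exact ⟨(isLocallyConstant_of_isSupportPoint hG hsep hnt hk hT hh).isClopen_fiber (h y), h y,
    fun _ hz => hz⟩
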